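/- Let $G$ be a (Hausdorff) locally compact abelian group, written additively, with Pontryagin dual $\widehat G$ and pairing $\langle x,\xi\rangle=\xi(x)$. Let $H\subseteq G$ be a compact open subgroup with annihilator $H^\perp=\{\xi\in\widehat G:\langle h,\xi\rangle=1 \text{ for all } h\in H\}$, and let $m_G$ be the Haar measure of $G$ normalized by $m_G(H)=1$. Let $A$ be a topological group automorphism of $G$ that is expansive with respect to $H$, i.e. $H\subsetneq AH$ and $\bigcap_{n\le 0}A^nH=\{0\}$. Let $A^*$ be its adjoint, the automorphism of $\widehat G$ with $\langle Ax,\xi\rangle=\langle x,A^*\xi\rangle$, and let $|A|>0$ be its modulus, defined by $m_G(AU)=|A|\,m_G(U)$ for all Borel sets $U$. For $\varphi\in L^2(G)$ and $\Lambda\subseteq G\times\widehat G$ let $S(\varphi,\Lambda)=\{M_\xi T_x\varphi\}_{(x,\xi)\in\Lambda}$ be the Gabor system, regarded as a family indexed by $\Lambda$, where $T_xf(y)=f(y-x)$ and $M_\xi f(y)=\langle y,\xi\rangle f(y)$. Let $\varphi=\chi_H$, let $k\in\mathbb Z$, and let $\Lambda_k\subseteq G\times\widehat G$ be a section of $G/H\times\widehat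 G/(A^{*})^{-k}H^\perp$, i.e. a set containing exactly one representative of each element of this product of quotients. Then: (i) if $k=0$, then $S(\varphi,\Lambda_0)$ is an orthonormal basis of $L^2(G)$; (ii) if $k>0$, then $S(\varphi,\Lambda_k)$ is a tight frame for $L^2(G)$ with constant $|A|^k$, i.e. $\sum_{(x,\xi)\in\Lambda_k}|\langle f,M_\xi T_x\varphi\rangle|^2=|A|^k\|f\|^2$ for all $f\in L^2(G)$; (iii) if $k<0$, then $S(\varphi,\Lambda_k)$ is incomplete in $L^2(G)$, i.e. its linear span is not dense. -/

import Mathlib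

open MeasureTheory

open scoped ENNReal InnerProductSpace

noncomputable section

/-- The Pontryagin dual `Ĝ` of an additively written topological group `G`: the (multiplicatively
written) group of continuous homomorphisms from `G` to the unit circle, with the compact-open
topology. -/
abbrev DualGroup (G : Type*) [AddCommGroup G] [TopologicalSpace G] : Type _ :=
  PontryaginDual (Multiplicative G)

/-- The pairing `⟨x, ξ⟩ = ξ(x)`, as a complex number of modulus one. -/
def pairing {G : Type*} [AddCommGroup G] [TopologicalSpace G] (x : G) (ξ : DualGroup G) : ℂ :=
  (ξ (Multiplicative.ofAdd x) : ℂ)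

/-- The annihilator `H^⊥ = {ξ ∈ Ĝ : ⟨h, ξ⟩ = 1 for all h ∈ H}`. -/
def annihilator {G : Type*} [AddCommGroup G] [TopologicalSpace G] (H : AddSubgroup G) :
    Subgroup (DualGroup G) where
  carrier := {ξ | ∀ h ∈ H, pairing h ξ = 1}
  one_mem' := by
    intro h _
    simp [pairing]
  mul_mem' := by
    intro ξ η hξ hη h hh
    have h1 := hξ h hh
    have h2 := hη h hh
    simp only [pairing] at h1 h2 ⊢
    change ((ξ (Multiplicative.ofAdd h) * η (Multiplicative.ofAdd h) : Circle) : ℂ) = 1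
    rw [Circle.coe_mul, h1, h2, one_mul]
  inv_mem' := by
    intro ξ hξ h hh
    have h1 := hξ h hh
    simp only [pairing] at h1 ⊢
    change (((ξ (Multiplicative.ofAdd h))⁻¹ : Circle) : ℂ) = 1
    rw [Circle.coe_inv, h1, inv_one]

/-- A continuous endomorphism of `G`, seen on the multiplicative copy of `G`. -/
def toMulHom {G : Type*} [AddCommGroup G] [TopologicalSpace G] (A : G ≃ₜ+ G) :
    Multiplicative G →ₜ* Multiplicative G where
  toMonoidHom := A.toAddEquiv.toAddMonoidHom.toMultiplicative
  continuous_toFun :=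
    continuous_ofAdd.comp (A.continuous_toFun.comp continuous_toAdd)

/-- The adjoint `A* ∈ Aut(Ĝ)` of `A ∈ Aut(G)`, given by `A* ξ = ξ ∘ A`. -/
def adjointAut {G : Type*} [AddCommGroup G] [TopologicalSpace G] (A : G ≃ₜ+ G) :
    DualGroup G ≃ₜ* DualGroup G where
  toFun := PontryaginDual.map (toMulHom A)
  invFun := PontryaginDual.map (toMulHom A.symm)
  left_inv := by
    intro ξ
    ext x
    change ((ξ (Multiplicative.ofAdd (A (A.symm x.toAdd))) : Circle) : ℂ) = ξ x
    rw [A.apply_symm_apply]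
    rfl
  right_inv := by
    intro ξ
    ext x
    change ((ξ (Multiplicative.ofAdd (A.symm (A x.toAdd))) : Circle) : ℂ) = ξ x
    rw [A.symm_apply_apply]
    rfl
  map_mul' := map_mul _
  continuous_toFun := (PontryaginDual.map (toMulHom A)).continuous_toFun
  continuous_invFun := (PontryaginDual.map (toMulHom A.symm)).continuous_toFun

/-- The defining property of the adjoint: `⟨A x, ξ⟩ = ⟨x, A* ξ⟩`. -/
theorem pairing_adjointAut {G : Type*} [AddCommGroup G] [TopologicalSpace G] (A : G ≃ₜ+ G)
    (x : G) (ξ : DualGroup G) : pairing (A x) ξ = pairing x (adjointAut A ξ) :=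
  rfl

/-- The subgroup `Aⁿ H` of `G`, for `n ∈ ℤ`. (The group law of `AddAut G` is composition, written
additively, so that `n • A` is the `n`-th iterate of `A`.) -/
def powSubgroup {G : Type*} [AddCommGroup G] [TopologicalSpace G] (A : G ≃ₜ+ G) (n : ℤ)
    (H : AddSubgroup G) : AddSubgroup G :=
  H.map (AddEquiv.toAddMonoidHom (n • (show AddAut G from A.toAddEquiv) : AddAut G))

/-- The subgroup `(A*)ⁿ K` of `Ĝ`, for `n ∈ ℤ`. -/
def dualPowSubgroup {G : Type*} [AddCommGroup G] [TopologicalSpace G] (A : G ≃ₜ+ G) (n : ℤ)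
    (K : Subgroup (DualGroup G)) : Subgroup (DualGroup G) :=
  K.map (MulEquiv.toMonoidHom
    ((show MulAut (DualGroup G) from (adjointAut A).toMulEquiv) ^ n : MulAut (DualGroup G)))

/-- `A` is expansive with respect to `H`: `H ⊊ A H`, and `⋂_{n ≤ 0} Aⁿ H = {0}`. -/
def IsExpansive {G : Type*} [AddCommGroup G] [TopologicalSpace G] (A : G ≃ₜ+ G)
    (H : AddSubgroup G) : Prop :=
  (H : Set G) ⊂ A '' (H : Set G) ∧
    (⋂ n : ℤ, ⋂ _ : n ≤ 0, (powSubgroup A n H : Set G)) = {0}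

/-- `Λ ⊆ G × Ĝ` is a section of `G/H × Ĝ/K`: it contains exactly one representative of each element
of `G/H × Ĝ/K`. (When `H` and `K` are open such a set is closed and discrete, hence measurable.) -/
def IsSection {G : Type*} [AddCommGroup G] [TopologicalSpace G] (H : AddSubgroup G)
    (K : Subgroup (DualGroup G)) (Λ : Set (G × DualGroup G)) : Prop :=
  ∀ (u : G ⧸ H) (v : DualGroup G ⧸ K),
    ∃! p : G × DualGroup G, p ∈ Λ ∧ (p.1 : G ⧸ H) = u ∧ (p.2 : DualGroup G ⧸ K) = v

theorem memLp_modulation {G : Type*} [AddCommGroup G] [TopologicalSpace G] [MeasurableSpace G]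
    [BorelSpace G] (μ : Measure G) (ξ : DualGroup G) (f : Lp ℂ 2 μ) :
    MemLp (fun y => pairing y ξ * f y) 2 μ := by
  have hc : Continuous fun y : G => pairing y ξ :=
    continuous_subtype_val.comp ((map_continuous ξ).comp continuous_ofAdd)
  refine (Lp.memLp f).of_le (hc.aestronglyMeasurable.mul (Lp.aestronglyMeasurable f)) ?_
  exact Filter.Eventually.of_forall fun y => by
    simp [pairing, Circle.norm_coe]

section Operators

variable {G : Type*} [AddCommGroup G] [TopologicalSpace G] [IsTopologicalAddGroup G]
  [MeasurableSpace G] [BorelSpace G] (μ : Measure G) [μ.IsAddHaarMeasure]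

/-- The translation operator `T_x f(y) = f(y - x)` on `L²(G)`. -/
def translationOp (x : G) (f : Lp ℂ 2 μ) : Lp ℂ 2 μ :=
  Lp.compMeasurePreserving (fun y => y - x) (measurePreserving_sub_right μ x) f

/-- The modulation operator `M_ξ f(y) = ⟨y, ξ⟩ f(y)` on `L²(G)`. -/
def modulationOp (ξ : DualGroup G) (f : Lp ℂ 2 μ) : Lp ℂ 2 μ :=
  (memLp_modulation μ ξ f).toLp _

/-- The Gabor system `S(φ, Λ) = {M_ξ T_x φ}_{(x, ξ) ∈ Λ}`, a family indexed by `Λ`. -/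
def gaborSystem (φ : Lp ℂ 2 μ) (Λ : Set (G × DualGroup G)) : Λ → Lp ℂ 2 μ :=
  fun p => modulationOp μ p.1.2 (translationOp μ p.1.1 φ)

end Operators

section HilbertSpace

variable {ι E : Type*} [NormedAddCommGroup E] [InnerProductSpace ℂ E]

/-- `v` is an orthonormal basis of `E` (a complete orthonormal system). -/
def IsOrthonormalBasis (v : ι → E) : Prop :=
  ∃ b : HilbertBasis ι ℂ E, ⇑b = v

/-- `v` is a frame with frame bounds `a, b > 0`:
`a ‖f‖² ≤ ∑ᵢ |⟨f, vᵢ⟩|² ≤ b ‖f‖²` for all `f`, the sum being finite. -/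
def IsFrameWithBounds (a b : ℝ) (v : ι → E) : Prop :=
  0 < a ∧ 0 < b ∧ ∀ f : E, Summable (fun i => ‖⟪v i, f⟫_ℂ‖ ^ 2) ∧
    a * ‖f‖ ^ 2 ≤ ∑' i, ‖⟪v i, f⟫_ℂ‖ ^ 2 ∧ ∑' i, ‖⟪v i, f⟫_ℂ‖ ^ 2 ≤ b * ‖f‖ ^ 2

/-- `v` is a tight frame with constant `c`: both frame bounds can be taken equal to `c`. -/
def IsTightFrame (c : ℝ) (v : ι → E) : Prop :=
  IsFrameWithBounds c c v

/-- `v` is complete: its linear span is dense. -/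
def IsCompleteSystem (v : ι → E) : Prop :=
  Dense (Submodule.span ℂ (Set.range v) : Set E)

end HilbertSpace

end

/-! Put `L = A^k H`, a compact open subgroup. Adjointness gives `(A*)^{-k} H^⊥ = L^⊥`
(`dualPowSubgroup_neg_annihilator`), so the system consists of the functions `⟨·, ξ⟩ χ_{x+H}` with
`x` modulo `H` and `ξ` modulo `L^⊥`. Since `A` strictly enlarges `H`, the sign of `k` decides
whether `L = H`, `H < L` or `L < H`.

For every compact open subgroup, its coset characters divided by the square root of its measure form
a Hilbert basis (`exists_hilbertBasis_cosetCharacter`). Orthogonality holds because a character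
nontrivial on the subgroup has integral zero over each coset. Totality is Stone–Weierstrass on each
compact coset, followed by density of compactly supported continuous functions. Characters separate
points because the subgroups `A^n H` with `n ≤ 0` meet in zero and each discrete quotient `G / A^n
H` has enough characters.

With `L = H` this is (i). If `H < L`, then `f χ_{x+H}` lives on one coset of `L`; Parseval there
gives `μ(L) ‖f χ_{x+H}‖²`, and summing over the cosets of `H` gives `μ(L) ‖f‖²` with `μ(L) = |A|^k`.
If `L < H`, some `η` lies in `L^⊥` but not in `H^⊥`, and shifting one frequency of the system by `η`
produces a nonzero vector orthogonal to all of it. -/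

noncomputable section

/-! ### Algebra of the pairing -/

section Pairing

variable {G : Type*} [AddCommGroup G] [TopologicalSpace G]

theorem norm_pairing (x : G) (ξ : DualGroup G) : ‖pairing x ξ‖ = 1 := Circle.norm_coe _

theorem pairing_add (x y : G) (ξ : DualGroup G) :
    pairing (x + y) ξ = pairing x ξ * pairing y ξ := by
  simp only [pairing, ofAdd_add, map_mul, Circle.coe_mul]

theorem pairing_neg (x : G) (ξ : DualGroup G) :
    pairing (-x) ξ = (starRingEnd ℂ) (pairing x ξ) := by
  simp only [pairing, ofAdd_neg, map_inv, Circle.coe_inv_eq_conj]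

theorem pairing_mul (x : G) (ξ η : DualGroup G) : pairing x (ξ * η) = pairing x ξ * pairing x η :=
  Circle.coe_mul _ _

theorem pairing_one (x : G) : pairing x (1 : DualGroup G) = 1 := rfl

theorem pairing_inv (x : G) (ξ : DualGroup G) :
    pairing x ξ⁻¹ = (starRingEnd ℂ) (pairing x ξ) :=
  Circle.coe_inv_eq_conj _

theorem conj_pairing_mul_self (x : G) (ξ : DualGroup G) :
    (starRingEnd ℂ) (pairing x ξ) * pairing x ξ = 1 := by
  rw [← pairing_inv, ← pairing_mul, inv_mul_cancel, pairing_one]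

theorem continuous_pairing (ξ : DualGroup G) : Continuous fun y : G => pairing y ξ :=
  continuous_subtype_val.comp ((map_continuous ξ).comp continuous_ofAdd)

theorem mem_annihilator {H : AddSubgroup G} {ξ : DualGroup G} :
    ξ ∈ annihilator H ↔ ∀ h ∈ H, pairing h ξ = 1 := Iff.rfl

theorem annihilator_anti {H L : AddSubgroup G} (h : H ≤ L) : annihilator L ≤ annihilator H :=
  fun _ hξ x hx => hξ x (h hx)

end Pairing

/-! ### Characters trivial on an open subgroup -/

section Characters

/-- The inclusion `ℚ/ℤ → ℝ/ℤ`. -/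
def ratToRealAddCircle : AddCircle (1 : ℚ) →+ AddCircle (1 : ℝ) :=
  QuotientAddGroup.map _ _ (Rat.castHom ℝ).toAddMonoidHom
    (AddSubgroup.zmultiples_le_of_mem ⟨1, by simp⟩)

theorem ratToRealAddCircle_injective : Function.Injective ratToRealAddCircle := by
  rw [injective_iff_map_eq_zero]
  intro a ha
  induction a using QuotientAddGroup.induction_on with
  | H q =>
    change ((q : ℝ) : AddCircle (1 : ℝ)) = 0 at ha
    change ((q : ℚ) : AddCircle (1 : ℚ)) = 0
    rw [AddCircle.coe_eq_zero_iff] at ha ⊢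
    obtain ⟨n, hn⟩ := ha
    refine ⟨n, ?_⟩
    simp only [zsmul_eq_mul, mul_one] at hn ⊢
    exact_mod_cast hn

/-- Continuous characters separate the points off an open subgroup from that subgroup. -/
theorem exists_mem_annihilator_pairing_ne_one {G : Type*} [AddCommGroup G] [TopologicalSpace G]
    [IsTopologicalAddGroup G] {U : AddSubgroup G} (hU : IsOpen (U : Set G)) {x : G} (hx : x ∉ U) :
    ∃ ξ ∈ annihilator U, pairing x ξ ≠ 1 := by
  have hx0 : (x : G ⧸ U) ≠ 0 := by rwa [Ne, QuotientAddGroup.eq_zero_iff]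
  -- `ℚ/ℤ` is an injective cogenerator, so the abstract group `G ⧸ U` has a character that is
  -- nonzero at `x`.
  obtain ⟨c, hc⟩ := CharacterModule.exists_character_apply_ne_zero_of_ne_zero hx0
  let c' : G ⧸ U →+ AddCircle (1 : ℚ) := c
  let d : G →+ AddCircle (1 : ℝ) :=
    ratToRealAddCircle.comp (c'.comp (QuotientAddGroup.mk' U))
  have hdU : ∀ h ∈ U, d h = 0 := by
    intro h hh
    have : (QuotientAddGroup.mk' U) h = 0 := (QuotientAddGroup.eq_zero_iff h).2 hh
    simp only [d, AddMonoidHom.comp_apply, this, map_zero]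
  let e : Multiplicative G →* Circle :=
    { toFun := fun y => AddCircle.toCircle (d y.toAdd)
      map_one' := by simp
      map_mul' := fun y z => by simp [AddCircle.toCircle_add] }
  -- A homomorphism trivial on the open subgroup `U` is locally constant at the identity, hence
  -- continuous.
  have he : Continuous e := by
    refine continuous_of_continuousAt_one e ?_
    refine (continuousAt_const (y := (1 : Circle))).congr ?_
    have : (Multiplicative.toAdd ⁻¹' (U : Set G)) ∈ nhds (1 : Multiplicative G) :=
      (hU.preimage continuous_toAdd).mem_nhds U.zero_mem
    filter_upwards [this] with y hy
    change 1 = AddCircle.toCircle (d y.toAdd)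
    rw [hdU y.toAdd hy, AddCircle.toCircle_zero]
  refine ⟨(⟨e, he⟩ : Multiplicative G →ₜ* Circle), ?_, ?_⟩
  · intro h hh
    change ((AddCircle.toCircle (d h) : Circle) : ℂ) = 1
    rw [hdU h hh, AddCircle.toCircle_zero, Circle.coe_one]
  · change ((AddCircle.toCircle (d x) : Circle) : ℂ) ≠ 1
    intro h
    have h1 : AddCircle.toCircle (d x) = AddCircle.toCircle (0 : AddCircle (1 : ℝ)) := by
      rw [AddCircle.toCircle_zero]
      exact Circle.ext h
    have h2 := AddCircle.injective_toCircle one_ne_zero h1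
    exact hc (ratToRealAddCircle_injective (h2.trans (map_zero _).symm))

end Characters

/-! ### Iterates of `H` under `A` and their annihilators -/

section Powers

variable {G : Type*} [AddCommGroup G] [TopologicalSpace G] (A : G ≃ₜ+ G) (H : AddSubgroup G)

theorem powSubgroup_zero : powSubgroup A 0 H = H := by
  ext x
  simp [powSubgroup, AddSubgroup.mem_map]

theorem coe_powSubgroup_add_one (n : ℤ) :
    (powSubgroup A (n + 1) H : Set G) = A '' (powSubgroup A n H : Set G) := by
  rw [powSubgroup, add_comm, one_add_zsmul]
  ext x
  simp only [powSubgroup, AddSubgroup.coe_map, Set.mem_image, exists_exists_and_eq_and]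
  rfl

theorem pairing_adjointAut_zpow (k : ℤ) (x : G) (ξ : DualGroup G) :
    pairing x (((show MulAut (DualGroup G) from (adjointAut A).toMulEquiv) ^ k :
      MulAut (DualGroup G)) ξ) =
    pairing ((k • (show AddAut G from A.toAddEquiv) : AddAut G) x) ξ := by
  induction k generalizing ξ with
  | zero => simp
  | succ n ih =>
    rw [zpow_add_one, add_comm, one_add_zsmul, MulAut.mul_apply, ih]
    rfl
  | pred n ih =>
    rw [zpow_sub_one, sub_eq_neg_add, add_zsmul, neg_one_zsmul, MulAut.mul_apply, ih]
    rfl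

/-- A character is trivial on `A^k H` exactly when its image under `(A*)^k` is trivial on `H`. This
moves the dilation from the dual to the subgroup. -/
theorem dualPowSubgroup_neg_annihilator (k : ℤ) :
    dualPowSubgroup A (-k) (annihilator H) = annihilator (powSubgroup A k H) := by
  ext ξ
  have h1 : ξ ∈ dualPowSubgroup A (-k) (annihilator H) ↔
      ((show MulAut (DualGroup G) from (adjointAut A).toMulEquiv) ^ k : MulAut (DualGroup G)) ξ ∈
        annihilator H := by
    rw [dualPowSubgroup, zpow_neg, Subgroup.mem_map]
    constructor
    · rintro ⟨η, hη, rfl⟩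
      convert hη
      exact MulAut.apply_inv_self _ _ _
    · intro h
      exact ⟨_, h, MulAut.inv_apply_self _ _ _⟩
  rw [h1]
  simp only [mem_annihilator, pairing_adjointAut_zpow, powSubgroup, AddSubgroup.mem_map,
    forall_exists_index, and_imp, forall_apply_eq_imp_iff₂]
  rfl

theorem isOpen_powSubgroup (hH : IsOpen (H : Set G)) (n : ℤ) :
    IsOpen (powSubgroup A n H : Set G) := by
  have key (m : ℤ) : IsOpen (powSubgroup A (m + 1) H : Set G) ↔
      IsOpen (powSubgroup A m H : Set G) := by
    rw [coe_powSubgroup_add_one]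
    exact A.toHomeomorph.isOpen_image
  induction n with
  | zero => rwa [powSubgroup_zero]
  | succ n ih => exact (key _).2 ih
  | pred n ih =>
    rw [← key]
    simpa using ih

theorem isCompact_powSubgroup (hH : IsCompact (H : Set G)) (n : ℤ) :
    IsCompact (powSubgroup A n H : Set G) := by
  have key (m : ℤ) : IsCompact (powSubgroup A (m + 1) H : Set G) ↔
      IsCompact (powSubgroup A m H : Set G) := by
    rw [coe_powSubgroup_add_one]
    exact A.toHomeomorph.isCompact_image
  induction n with
  | zero => rwa [powSubgroup_zero]
  | succ n ih => exact (key _).2 ih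
  | pred n ih =>
    rw [← key]
    simpa using ih

variable {A H}

theorem strictMono_powSubgroup (hA : (H : Set G) ⊂ A '' (H : Set G)) :
    StrictMono fun n : ℤ => powSubgroup A n H := by
  have key (m : ℤ) : powSubgroup A (m + 1) H < powSubgroup A (m + 1 + 1) H ↔
      powSubgroup A m H < powSubgroup A (m + 1) H := by
    rw [← SetLike.coe_ssubset_coe, coe_powSubgroup_add_one _ _ (m + 1),
      ← SetLike.coe_ssubset_coe (S := powSubgroup A m H)]
    nth_rw 1 [coe_powSubgroup_add_one _ _ m]
    simp only [ssubset_iff_subset_not_subset, Set.image_subset_image_iff A.injective]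
  refine strictMono_int_of_lt_succ fun n => ?_
  induction n with
  | zero =>
    rw [← SetLike.coe_ssubset_coe, coe_powSubgroup_add_one, powSubgroup_zero]
    exact hA
  | succ n ih => exact (key _).2 ih
  | pred n ih =>
    rw [← key]
    simpa using ih

theorem measure_powSubgroup [IsTopologicalAddGroup G] [LocallyCompactSpace G] [MeasurableSpace G]
    [BorelSpace G] (μ : Measure G) [μ.IsAddHaarMeasure] [μ.Regular] (n : ℕ) :
    μ (powSubgroup A n H : Set G) = (addEquivAddHaarChar A : ℝ≥0∞) ^ n * μ (H : Set G) := by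
  induction n with
  | zero => simp [powSubgroup_zero]
  | succ n ih =>
    rw [Nat.cast_succ, coe_powSubgroup_add_one,
      ← addEquivAddHaarChar_smul_preimage μ A, Set.preimage_image_eq _ A.injective, ih, pow_succ',
      mul_assoc]
    rfl

/-- A nonzero `x` lies outside some open `A^n H`, and a character of the quotient by it detects `x`.
-/
theorem IsExpansive.exists_pairing_ne_one [IsTopologicalAddGroup G] (hA : IsExpansive A H)
    (hH : IsOpen (H : Set G)) {x : G} (hx : x ≠ 0) : ∃ ξ : DualGroup G, pairing x ξ ≠ 1 := by
  have h : x ∉ ⋂ n : ℤ, ⋂ _ : n ≤ 0, (powSubgroup A n H : Set G) := by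
    rw [hA.2]
    exact hx
  simp only [Set.mem_iInter, not_forall] at h
  obtain ⟨n, -, hn⟩ := h
  obtain ⟨ξ, -, hξ⟩ := exists_mem_annihilator_pairing_ne_one (isOpen_powSubgroup A H hH n) hn
  exact ⟨ξ, hξ⟩

end Powers

/-! ### Density of characters on compact sets -/

section CharactersDense

variable {G : Type*} [AddCommGroup G] [TopologicalSpace G]

/-- The restriction of a character of `G` to a subset of `G`, as a continuous function. -/
def restrictCharacter (S : Set G) (ξ : DualGroup G) : C(S, ℂ) where
  toFun y := pairing (y : G) ξ
  continuous_toFun := (continuous_pairing ξ).comp continuous_subtype_val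

/-- The star subalgebra of `C(S, ℂ)` generated by the characters of `G`. -/
def characterSubalgebra (S : Set G) : StarSubalgebra ℂ C(S, ℂ) where
  toSubalgebra := Algebra.adjoin ℂ (Set.range (restrictCharacter S))
  star_mem' := by
    change Algebra.adjoin ℂ (Set.range (restrictCharacter S)) ≤
      star (Algebra.adjoin ℂ (Set.range (restrictCharacter S)))
    refine Algebra.adjoin_le ?_
    rintro - ⟨ξ, rfl⟩
    exact Algebra.subset_adjoin ⟨ξ⁻¹, ContinuousMap.ext fun _ => pairing_inv _ _⟩

/-- Characters are closed under products, so linear combinations already form an algebra. -/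
theorem toSubmodule_characterSubalgebra (S : Set G) :
    Subalgebra.toSubmodule (characterSubalgebra S).toSubalgebra =
      Submodule.span ℂ (Set.range (restrictCharacter S)) := by
  apply Algebra.adjoin_eq_span_of_subset
  refine Set.Subset.trans ?_ Submodule.subset_span
  intro x hx
  refine Submonoid.closure_induction (fun _ => id) ⟨1, ?_⟩ ?_ hx
  · ext y
    exact pairing_one (y : G)
  · rintro - - - - ⟨ξ, rfl⟩ ⟨η, rfl⟩
    exact ⟨ξ * η, ContinuousMap.ext fun _ => pairing_mul _ _ _⟩

theorem span_restrictCharacter_closure_eq_top {S : Set G} (hS : IsCompact S)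
    (hsep : ∀ x : G, x ≠ 0 → ∃ ξ : DualGroup G, pairing x ξ ≠ 1) :
    (Submodule.span ℂ (Set.range (restrictCharacter S))).topologicalClosure = ⊤ := by
  have : CompactSpace S := isCompact_iff_compactSpace.1 hS
  have hs : (characterSubalgebra S).SeparatesPoints := by
    intro x y hxy
    obtain ⟨ξ, hξ⟩ := hsep (x - y : G) (sub_ne_zero.2 fun h => hxy (Subtype.ext h))
    refine ⟨_, ⟨restrictCharacter S ξ, Algebra.subset_adjoin ⟨ξ, rfl⟩, rfl⟩, fun h => hξ ?_⟩
    change pairing (x : G) ξ = pairing (y : G) ξ at h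
    rw [sub_eq_add_neg, pairing_add, pairing_neg, h, mul_comm, conj_pairing_mul_self]
  rw [← toSubmodule_characterSubalgebra]
  exact congr_arg (Subalgebra.toSubmodule <| StarSubalgebra.toSubalgebra ·)
    (ContinuousMap.starSubalgebra_topologicalClosure_eq_top_of_separatesPoints _ hs)

/-- A function on a compact set `S` that is orthogonal to all characters is orthogonal to all
continuous functions. -/
theorem setIntegral_mul_eq_zero_of_characters [T2Space G] [MeasurableSpace G] [BorelSpace G]
    {μ : Measure G} {S : Set G} (hS : IsCompact S)
    (hsep : ∀ x : G, x ≠ 0 → ∃ ξ : DualGroup G, pairing x ξ ≠ 1)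
    {f : G → ℂ} (hf : IntegrableOn f S μ)
    (h : ∀ ξ : DualGroup G, ∫ y in S, pairing y ξ * f y ∂μ = 0) {g : G → ℂ} (hg : Continuous g) :
    ∫ y in S, g y * f y ∂μ = 0 := by
  have : CompactSpace S := isCompact_iff_compactSpace.1 hS
  have hSm : MeasurableSet S := hS.measurableSet
  set ν : Measure S := μ.comap Subtype.val
  have hfν : Integrable (fun y : S => f y) ν := (integrableOn_iff_comap_subtypeVal hSm).1 hf
  have hint (u : C(S, ℂ)) : Integrable (fun y : S => u y * f y) ν :=
    hfν.bdd_mul (c := ‖u‖) u.continuous.aestronglyMeasurable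
      (Filter.Eventually.of_forall u.norm_coe_le_norm)
  -- Integration against `f ∈ L¹(S)` is sup-norm continuous, so its kernel is closed and contains
  -- the closed span of the characters.
  let Φ : C(S, ℂ) →L[ℂ] ℂ := LinearMap.mkContinuous
    { toFun := fun u => ∫ y, u y * f y ∂ν
      map_add' := fun u v => by
        rw [← integral_add (hint u) (hint v)]
        simp only [ContinuousMap.add_apply, add_mul]
      map_smul' := fun c u => by
        rw [RingHom.id_apply, smul_eq_mul, ← integral_const_mul]
        simp only [ContinuousMap.smul_apply, smul_eq_mul, mul_assoc] }
    (∫ y, ‖f y‖ ∂ν) (fun u => by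
      rw [mul_comm, ← integral_const_mul]
      refine norm_integral_le_of_norm_le (hfν.norm.const_mul _)
        (Filter.Eventually.of_forall fun y => ?_)
      rw [norm_mul]
      exact mul_le_mul_of_nonneg_right (u.norm_coe_le_norm y) (norm_nonneg _))
  have hker : Submodule.span ℂ (Set.range (restrictCharacter S)) ≤ LinearMap.ker Φ.toLinearMap := by
    rw [Submodule.span_le]
    rintro - ⟨ξ, rfl⟩
    change ∫ y : S, pairing (y : G) ξ * f y ∂ν = 0
    rw [integral_subtype_comap hSm fun y : G => pairing y ξ * f y]
    exact h ξ
  have htop : (⊤ : Submodule ℂ C(S, ℂ)) ≤ LinearMap.ker Φ.toLinearMap := by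
    rw [← span_restrictCharacter_closure_eq_top hS hsep]
    exact Submodule.topologicalClosure_minimal _ hker Φ.isClosed_ker
  have := htop (Submodule.mem_top (x := (⟨fun y : S => g y, by fun_prop⟩ : C(S, ℂ))))
  change ∫ y : S, g y * f y ∂ν = 0 at this
  rwa [integral_subtype_comap hSm fun y : G => g y * f y] at this

end CharactersDense

/-! ### Cosets of open and compact subgroups -/

section Cosets

variable {G : Type*} [AddCommGroup G]

/-- The coset `x + L`. -/
def cosetSet (L : AddSubgroup G) (x : G) : Set G := (fun y => y - x) ⁻¹' (L : Set G)

theorem mem_cosetSet {L : AddSubgroup G} {x y : G} : y ∈ cosetSet L x ↔ y - x ∈ L := Iff.rfl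

theorem mem_cosetSet_iff_mk {L : AddSubgroup G} {x y : G} :
    y ∈ cosetSet L x ↔ (y : G ⧸ L) = (x : G ⧸ L) := by
  rw [mem_cosetSet, eq_comm, QuotientAddGroup.eq, neg_add_eq_sub]

theorem cosetSet_congr {L : AddSubgroup G} {x y : G} (h : (x : G ⧸ L) = (y : G ⧸ L)) :
    cosetSet L x = cosetSet L y := by
  ext z
  rw [mem_cosetSet_iff_mk, mem_cosetSet_iff_mk, h]

theorem disjoint_cosetSet {L : AddSubgroup G} {x y : G} (h : (x : G ⧸ L) ≠ (y : G ⧸ L)) :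
    Disjoint (cosetSet L x) (cosetSet L y) := by
  rw [Set.disjoint_left]
  intro z hx hy
  rw [mem_cosetSet_iff_mk] at hx hy
  exact h (hx.symm.trans hy)

theorem cosetSet_mono {H L : AddSubgroup G} (h : H ≤ L) (x : G) : cosetSet H x ⊆ cosetSet L x :=
  fun _ hy => h hy

variable [TopologicalSpace G]

theorem pairing_eq_of_mem_cosetSet {L : AddSubgroup G} {x y : G} (h : y ∈ cosetSet L x)
    {ξ : DualGroup G} (hξ : ξ ∈ annihilator L) : pairing y ξ = pairing x ξ := by
  rw [← sub_add_cancel y x, pairing_add, hξ _ h, one_mul]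

variable [IsTopologicalAddGroup G]

theorem isOpen_cosetSet {L : AddSubgroup G} (hL : IsOpen (L : Set G)) (x : G) :
    IsOpen (cosetSet L x) :=
  hL.preimage (by fun_prop)

theorem isCompact_cosetSet {L : AddSubgroup G} (hL : IsCompact (L : Set G)) (x : G) :
    IsCompact (cosetSet L x) :=
  (Homeomorph.subRight x).isCompact_preimage.2 hL

/-- A group with a compact open subgroup is a disjoint union of compact open subsets, hence
normal. -/
theorem normalSpace_of_isCompact_isOpen [T2Space G] {L : AddSubgroup G}
    (hLo : IsOpen (L : Set G)) (hLc : IsCompact (L : Set G)) : NormalSpace G where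
  normal s t hs ht hst := by
    have h (u : G ⧸ L) : SeparatedNhds (cosetSet L u.out ∩ s) (cosetSet L u.out ∩ t) :=
      SeparatedNhds.of_isCompact_isCompact ((isCompact_cosetSet hLc _).inter_right hs)
        ((isCompact_cosetSet hLc _).inter_right ht)
        (hst.mono Set.inter_subset_right Set.inter_subset_right)
    choose U V hU hV hsU htV hUV using h
    have hmem (y : G) : y ∈ cosetSet L (y : G ⧸ L).out :=
      mem_cosetSet_iff_mk.2 (Quotient.out_eq' _).symm
    refine ⟨⋃ u, cosetSet L u.out ∩ U u, ⋃ u, cosetSet L u.out ∩ V u,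
      isOpen_iUnion fun u => (isOpen_cosetSet hLo _).inter (hU u),
      isOpen_iUnion fun u => (isOpen_cosetSet hLo _).inter (hV u),
      fun y hy => Set.mem_iUnion.2 ⟨y, hmem y, hsU _ ⟨hmem y, hy⟩⟩,
      fun y hy => Set.mem_iUnion.2 ⟨y, hmem y, htV _ ⟨hmem y, hy⟩⟩, ?_⟩
    rw [Set.disjoint_iUnion_left]
    intro u
    rw [Set.disjoint_iUnion_right]
    intro v
    rcases eq_or_ne u v with rfl | huv
    · exact (hUV u).mono Set.inter_subset_right Set.inter_subset_right
    · refine (disjoint_cosetSet ?_).mono Set.inter_subset_left Set.inter_subset_left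
      rwa [show ((u.out : G) : G ⧸ L) = u from Quotient.out_eq' _,
        show ((v.out : G) : G ⧸ L) = v from Quotient.out_eq' _]

variable [MeasurableSpace G]

theorem measure_cosetSet_ne_top (μ : Measure G) [μ.IsAddHaarMeasure] {L : AddSubgroup G}
    (hL : IsCompact (L : Set G)) (x : G) : μ (cosetSet L x) ≠ ∞ :=
  (isCompact_cosetSet hL x).measure_ne_top

variable [BorelSpace G]

theorem measurableSet_cosetSet {L : AddSubgroup G} (hL : IsOpen (L : Set G)) (x : G) :
    MeasurableSet (cosetSet L x) :=
  (isOpen_cosetSet hL x).measurableSet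

variable (μ : Measure G) [μ.IsAddHaarMeasure]

theorem measure_cosetSet {L : AddSubgroup G} (x : G) :
    μ (cosetSet L x) = μ (L : Set G) := by
  simp only [cosetSet, sub_eq_add_neg]
  exact measure_preimage_add_right μ _ _

/-- Translation by some `h ∈ L` with `⟨h, ξ⟩ ≠ 1` preserves the coset and multiplies the integral by
`⟨h, ξ⟩`. -/
theorem setIntegral_cosetSet_pairing {L : AddSubgroup G} (hL : IsOpen (L : Set G)) (x : G)
    {ξ : DualGroup G} (hξ : ξ ∉ annihilator L) : ∫ y in cosetSet L x, pairing y ξ ∂μ = 0 := by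
  rw [mem_annihilator] at hξ
  push Not at hξ
  obtain ⟨h, hh, hne⟩ := hξ
  have key : ∫ y in cosetSet L x, pairing y ξ ∂μ =
      pairing h ξ * ∫ y in cosetSet L x, pairing y ξ ∂μ := by
    rw [← integral_indicator (measurableSet_cosetSet hL x)]
    conv_lhs => rw [← integral_add_right_eq_self _ h]
    rw [← integral_const_mul]
    refine integral_congr_ae (Filter.Eventually.of_forall fun y => ?_)
    have hiff : y + h ∈ cosetSet L x ↔ y ∈ cosetSet L x := by
      rw [mem_cosetSet, mem_cosetSet, add_sub_right_comm, AddSubgroup.add_mem_cancel_right _ hh]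
    by_cases hy : y ∈ cosetSet L x
    · simp only [Set.indicator_of_mem hy, Set.indicator_of_mem (hiff.2 hy), pairing_add, mul_comm]
    · simp only [Set.indicator_of_notMem hy, Set.indicator_of_notMem (mt hiff.1 hy), mul_zero]
  have : (1 - pairing h ξ) * ∫ y in cosetSet L x, pairing y ξ ∂μ = 0 := by
    rw [sub_mul, one_mul, ← key, sub_self]
  exact (mul_eq_zero.1 this).resolve_left (sub_ne_zero.2 hne.symm)

end Cosets

/-! ### Restriction of square-integrable functions -/

section Restriction

variable {α : Type*} [MeasurableSpace α] (μ : Measure α)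

/-- The restriction `χ_S f` of `f ∈ L²` to `S`. -/
def restrictLp {S : Set α} (hS : MeasurableSet S) (f : Lp ℂ 2 μ) : Lp ℂ 2 μ :=
  ((Lp.memLp f).indicator hS).toLp (S.indicator (f : α → ℂ))

theorem coeFn_restrictLp {S : Set α} (hS : MeasurableSet S) (f : Lp ℂ 2 μ) :
    (restrictLp μ hS f : α → ℂ) =ᵐ[μ] S.indicator (f : α → ℂ) :=
  MemLp.coeFn_toLp _

theorem setIntegral_mul_restrictLp {S T : Set α} (hS : MeasurableSet S) (f : Lp ℂ 2 μ)
    (g : α → ℂ) :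
    ∫ y in T, g y * restrictLp μ hS f y ∂μ = ∫ y in T ∩ S, g y * f y ∂μ := by
  rw [← setIntegral_indicator hS]
  refine integral_congr_ae (ae_restrict_of_ae ?_)
  filter_upwards [coeFn_restrictLp μ hS f] with y hy
  rw [hy]
  by_cases h : y ∈ S <;> simp [h]

end Restriction

/-! ### Characters cut off to a set -/

section SetCharacters

variable {G : Type*} [AddCommGroup G] [TopologicalSpace G] [MeasurableSpace G] (μ : Measure G)

/-- On a subset of a coset of `L`, the size of the coefficient of `f` at a character only depends
on the class of the character modulo `L^⊥`. -/
theorem norm_setIntegral_pairing_congr {L : AddSubgroup G} {S : Set G} {x : G}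
    (hS : MeasurableSet S) (hSx : S ⊆ cosetSet L x) {ξ η : DualGroup G}
    (h : (ξ : DualGroup G ⧸ annihilator L) = η) (f : G → ℂ) :
    ‖∫ y in S, pairing y ξ⁻¹ * f y ∂μ‖ = ‖∫ y in S, pairing y η⁻¹ * f y ∂μ‖ := by
  have hm : ξ⁻¹ * η ∈ annihilator L := QuotientGroup.eq.1 h
  have key : ∫ y in S, pairing y ξ⁻¹ * f y ∂μ =
      pairing x (ξ⁻¹ * η) * ∫ y in S, pairing y η⁻¹ * f y ∂μ := by
    rw [← integral_const_mul]
    refine setIntegral_congr_fun hS fun y hy => ?_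
    change _ = pairing x (ξ⁻¹ * η) * (pairing y η⁻¹ * f y)
    rw [← pairing_eq_of_mem_cosetSet (hSx hy) hm, ← mul_assoc, ← pairing_mul,
      mul_inv_cancel_right]
  rw [key, norm_mul, norm_pairing, one_mul]

variable [BorelSpace G]

/-- The element `⟨·, ξ⟩ χ_S` of `L²(G)`. -/
def setCharacter {S : Set G} (hS : MeasurableSet S) (hμS : μ S ≠ ∞) (ξ : DualGroup G) :
    Lp ℂ 2 μ :=
  modulationOp μ ξ (indicatorConstLp 2 hS hμS (1 : ℂ))

theorem coeFn_setCharacter {S : Set G} (hS : MeasurableSet S) (hμS : μ S ≠ ∞)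
    (ξ : DualGroup G) :
    setCharacter μ hS hμS ξ =ᵐ[μ] S.indicator fun y => pairing y ξ := by
  have h1 : setCharacter μ hS hμS ξ =ᵐ[μ] fun y => pairing y ξ * _ :=
    MemLp.coeFn_toLp (memLp_modulation μ ξ (indicatorConstLp 2 hS hμS (1 : ℂ)))
  filter_upwards [h1, indicatorConstLp_coeFn (p := 2) (hs := hS) (hμs := hμS) (c := (1 : ℂ))]
    with y hy1 hy2
  rw [hy1, hy2]
  by_cases h : y ∈ S <;> simp [h]

theorem inner_setCharacter {S : Set G} (hS : MeasurableSet S) (hμS : μ S ≠ ∞)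
    (ξ : DualGroup G) (f : Lp ℂ 2 μ) :
    ⟪setCharacter μ hS hμS ξ, f⟫_ℂ = ∫ y in S, pairing y ξ⁻¹ * f y ∂μ := by
  rw [L2.inner_def, ← integral_indicator hS]
  refine integral_congr_ae ?_
  filter_upwards [coeFn_setCharacter μ hS hμS ξ] with y hy
  rw [hy]
  by_cases h : y ∈ S
  · simp [h, pairing_inv, mul_comm]
  · simp [h]

theorem inner_setCharacter_setCharacter {S T : Set G} (hS : MeasurableSet S) (hμS : μ S ≠ ∞)
    (hT : MeasurableSet T) (hμT : μ T ≠ ∞) (ξ η : DualGroup G) :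
    ⟪setCharacter μ hS hμS ξ, setCharacter μ hT hμT η⟫_ℂ =
      ∫ y in S ∩ T, pairing y (ξ⁻¹ * η) ∂μ := by
  rw [inner_setCharacter, ← setIntegral_indicator hT]
  refine integral_congr_ae (ae_restrict_of_ae ?_)
  filter_upwards [coeFn_setCharacter μ hT hμT η] with y hy
  rw [hy]
  by_cases h : y ∈ T
  · simp [h, pairing_mul]
  · simp [h]

theorem norm_setCharacter_sq {S : Set G} (hS : MeasurableSet S) (hμS : μ S ≠ ∞)
    (ξ : DualGroup G) : ‖setCharacter μ hS hμS ξ‖ ^ 2 = μ.real S := by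
  have h := inner_self_eq_norm_sq_to_K (𝕜 := ℂ) (setCharacter μ hS hμS ξ)
  rw [inner_setCharacter_setCharacter, Set.inter_self, inv_mul_cancel] at h
  simp only [pairing_one, setIntegral_const, Complex.real_smul, mul_one] at h
  exact Complex.ofReal_injective (by rw [h]; push_cast; rfl)

variable [IsTopologicalAddGroup G] [μ.IsAddHaarMeasure]

theorem gaborSystem_indicator {H : AddSubgroup G} (hHo : IsOpen (H : Set G))
    (hHc : IsCompact (H : Set G)) (hμH : μ (H : Set G) ≠ ∞) (Λ : Set (G × DualGroup G)) (p : Λ) :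
    gaborSystem μ (indicatorConstLp 2 hHo.measurableSet hμH (1 : ℂ)) Λ p =
      setCharacter μ (measurableSet_cosetSet hHo p.1.1) (measure_cosetSet_ne_top μ hHc p.1.1)
        p.1.2 := by
  rw [gaborSystem, setCharacter, translationOp, Lp.indicatorConstLp_compMeasurePreserving]
  rfl

end SetCharacters

/-! ### Totality of the coset characters -/

section Totality

variable {G : Type*} [AddCommGroup G] [TopologicalSpace G] [IsTopologicalAddGroup G] [T2Space G]
  [MeasurableSpace G] [BorelSpace G] (μ : Measure G)
  [μ.IsAddHaarMeasure] {L : AddSubgroup G}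

/-- A function orthogonal to every character on every coset of `L` is orthogonal to every compactly
supported continuous function. -/
theorem integral_mul_eq_zero_of_cosetSet (hLo : IsOpen (L : Set G)) (hLc : IsCompact (L : Set G))
    (hsep : ∀ x : G, x ≠ 0 → ∃ ξ : DualGroup G, pairing x ξ ≠ 1) (f : Lp ℂ 2 μ)
    (h : ∀ (x : G) (ξ : DualGroup G), ∫ y in cosetSet L x, pairing y ξ * f y ∂μ = 0)
    {g : G → ℂ} (hg : Continuous g) (hgc : HasCompactSupport g) :
    ∫ y, g y * f y ∂μ = 0 := by
  have hfi (x : G) : IntegrableOn f (cosetSet L x) μ :=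
    integrableOn_Lp_of_measure_ne_top f (by norm_num) (measure_cosetSet_ne_top μ hLc x)
  have hz (x : G) : ∫ y in cosetSet L x, g y * f y ∂μ = 0 :=
    setIntegral_mul_eq_zero_of_characters (isCompact_cosetSet hLc x) hsep (hfi x) (h x) hg
  -- The compact support of `g` meets only finitely many cosets, so the integral is a finite sum
  -- even when `G ⧸ L` is uncountable.
  have : DiscreteTopology (G ⧸ L) := QuotientAddGroup.discreteTopology hLo
  have hfin : ((fun y : G => (y : G ⧸ L)) '' tsupport g).Finite :=
    (hgc.isCompact.image continuous_quotient_mk').finite_of_discrete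
  set t := hfin.toFinset
  have hsupp : Function.support (fun y => g y * f y) ⊆ ⋃ u ∈ t, cosetSet L u.out := by
    intro y hy
    simp only [Set.mem_iUnion, exists_prop]
    refine ⟨(y : G ⧸ L), ?_, ?_⟩
    · rw [Set.Finite.mem_toFinset]
      exact ⟨y, subset_tsupport _ fun h0 => hy (by simp [h0]), rfl⟩
    · rw [mem_cosetSet_iff_mk]
      exact (Quotient.out_eq' _).symm
  rw [← setIntegral_eq_integral_of_forall_compl_eq_zero
    fun y hy => Function.notMem_support.1 fun h => hy (hsupp h), integral_biUnion_finset]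
  · exact Finset.sum_eq_zero fun u _ => hz _
  · exact fun u _ => measurableSet_cosetSet hLo _
  · intro u _ v _ huv
    refine disjoint_cosetSet ?_
    rwa [show ((u.out : G) : G ⧸ L) = u from Quotient.out_eq' _,
      show ((v.out : G) : G ⧸ L) = v from Quotient.out_eq' _]
  · intro u _
    obtain ⟨C, hC⟩ := hg.bounded_above_of_compact_support hgc
    exact (hfi _).bdd_mul (c := C) hg.aestronglyMeasurable (Filter.Eventually.of_forall hC)

/-- If `f ≠ 0`, a compactly supported continuous `g` within `‖f‖ / 2` of `f` is still orthogonal to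
`f`, which forces `‖f‖² ≤ ‖f‖² / 2`. -/
theorem eq_zero_of_setIntegral_cosetSet [LocallyCompactSpace G] [μ.Regular]
    (hLo : IsOpen (L : Set G))
    (hLc : IsCompact (L : Set G))
    (hsep : ∀ x : G, x ≠ 0 → ∃ ξ : DualGroup G, pairing x ξ ≠ 1) (f : Lp ℂ 2 μ)
    (h : ∀ (x : G) (ξ : DualGroup G), ∫ y in cosetSet L x, pairing y ξ * f y ∂μ = 0) :
    f = 0 := by
  have : NormalSpace G := normalSpace_of_isCompact_isOpen hLo hLc
  by_contra hf
  have hpos : 0 < ‖f‖ := norm_pos_iff.2 hf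
  obtain ⟨g, hgc, hfg, hg, hgm⟩ :=
    (Lp.memLp f).exists_hasCompactSupport_eLpNorm_sub_le (by norm_num)
    (ε := ENNReal.ofReal (‖f‖ / 2)) (by simpa using hf)
  have h0 : ⟪hgm.toLp g, f⟫_ℂ = 0 := by
    rw [L2.inner_def, ← integral_mul_eq_zero_of_cosetSet μ hLo hLc hsep f h
      (g := fun y => (starRingEnd ℂ) (g y)) (Complex.continuous_conj.comp hg)
      (hgc.comp_left (map_zero _))]
    refine integral_congr_ae ?_
    filter_upwards [hgm.coeFn_toLp] with y hy
    rw [hy, RCLike.inner_apply, mul_comm]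
  have hn : ‖f - hgm.toLp g‖ ≤ ‖f‖ / 2 := by
    rw [Lp.norm_def]
    refine ENNReal.toReal_le_of_le_ofReal (by positivity) ((eLpNorm_congr_ae ?_).trans_le hfg)
    filter_upwards [Lp.coeFn_sub f (hgm.toLp g), hgm.coeFn_toLp] with y hy1 hy2
    rw [hy1, Pi.sub_apply, Pi.sub_apply, hy2]
  have h1 : ‖f‖ ^ 2 ≤ ‖f‖ / 2 * ‖f‖ := by
    calc ‖f‖ ^ 2 = ‖⟪f, f⟫_ℂ‖ := by rw [inner_self_eq_norm_sq_to_K]; simp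
      _ = ‖⟪f - hgm.toLp g, f⟫_ℂ‖ := by rw [inner_sub_left, h0, sub_zero]
      _ ≤ ‖f - hgm.toLp g‖ * ‖f‖ := norm_inner_le_norm _ _
      _ ≤ ‖f‖ / 2 * ‖f‖ := by gcongr
  nlinarith

end Totality

/-! ### Hilbert bases of coset characters and Parseval identities -/

section CosetBasis

theorem measureReal_pos_of_isOpen_isCompact {G : Type*} [AddCommGroup G] [TopologicalSpace G]
    [MeasurableSpace G] (μ : Measure G) [μ.IsAddHaarMeasure] {L : AddSubgroup G}
    (hLo : IsOpen (L : Set G)) (hLc : IsCompact (L : Set G)) : 0 < μ.real (L : Set G) :=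
  ENNReal.toReal_pos (hLo.measure_pos μ ⟨0, L.zero_mem⟩).ne' hLc.measure_ne_top

/-- The representatives of `G/L × Ĝ/K` given by `Quotient.out` form a section. -/
theorem bijective_mk_out {G : Type*} [AddCommGroup G] [TopologicalSpace G] (L : AddSubgroup G)
    (K : Subgroup (DualGroup G)) :
    Function.Bijective fun u : (G ⧸ L) × (DualGroup G ⧸ K) =>
      (((u.1.out : G) : G ⧸ L), ((u.2.out : DualGroup G) : DualGroup G ⧸ K)) := by
  have h : (fun u : (G ⧸ L) × (DualGroup G ⧸ K) =>
      (((u.1.out : G) : G ⧸ L), ((u.2.out : DualGroup G) : DualGroup G ⧸ K))) = id :=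
    funext fun u => Prod.ext (Quotient.out_eq' u.1) (Quotient.out_eq' u.2)
  rw [h]
  exact Function.bijective_id

variable {G : Type*} [AddCommGroup G] [TopologicalSpace G] [IsTopologicalAddGroup G]
  [MeasurableSpace G] [BorelSpace G] (μ : Measure G) [μ.IsAddHaarMeasure]
  {L : AddSubgroup G} (hLo : IsOpen (L : Set G)) (hLc : IsCompact (L : Set G))

/-- The element `⟨·, ξ⟩ χ_{x + L}` of `L²(G)`. -/
def cosetCharacter (x : G) (ξ : DualGroup G) : Lp ℂ 2 μ :=
  setCharacter μ (measurableSet_cosetSet hLo x) (measure_cosetSet_ne_top μ hLc x) ξ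

theorem inner_cosetCharacter (x : G) (ξ : DualGroup G) (f : Lp ℂ 2 μ) :
    ⟪cosetCharacter μ hLo hLc x ξ, f⟫_ℂ = ∫ y in cosetSet L x, pairing y ξ⁻¹ * f y ∂μ :=
  inner_setCharacter μ _ _ ξ f

theorem inner_cosetCharacter_eq_zero {x x' : G} {ξ ξ' : DualGroup G}
    (h : ((x : G ⧸ L), (ξ : DualGroup G ⧸ annihilator L)) ≠ ((x' : G ⧸ L), (ξ' : _ ⧸ _))) :
    ⟪cosetCharacter μ hLo hLc x ξ, cosetCharacter μ hLo hLc x' ξ'⟫_ℂ = 0 := by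
  rw [cosetCharacter, cosetCharacter, inner_setCharacter_setCharacter]
  by_cases hx : (x : G ⧸ L) = x'
  · rw [← cosetSet_congr hx, Set.inter_self]
    refine setIntegral_cosetSet_pairing μ hLo x fun hm => h ?_
    rw [hx, QuotientGroup.eq.2 hm]
  · rw [(disjoint_cosetSet hx).inter_eq, setIntegral_empty]

theorem norm_cosetCharacter_sq (x : G) (ξ : DualGroup G) :
    ‖cosetCharacter μ hLo hLc x ξ‖ ^ 2 = μ.real (L : Set G) := by
  rw [cosetCharacter, norm_setCharacter_sq, measureReal_def, measure_cosetSet, measureReal_def]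

variable [LocallyCompactSpace G] [T2Space G] [μ.Regular]
  (hsep : ∀ x : G, x ≠ 0 → ∃ ξ : DualGroup G, pairing x ξ ≠ 1)
  {ι : Type*} {p : ι → G × DualGroup G}
  (hp : Function.Bijective fun i =>
    (((p i).1 : G ⧸ L), ((p i).2 : DualGroup G ⧸ annihilator L)))

include hsep hp in
/-- The normalized characters of the cosets of `L` form a Hilbert basis of `L²(G)`. -/
theorem exists_hilbertBasis_cosetCharacter :
    ∃ b : HilbertBasis ι ℂ (Lp ℂ 2 μ), ∀ i, b i =
      (((√(μ.real (L : Set G)))⁻¹ : ℝ) : ℂ) • cosetCharacter μ hLo hLc (p i).1 (p i).2 := by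
  have hpos := measureReal_pos_of_isOpen_isCompact μ hLo hLc
  set v : ι → Lp ℂ 2 μ := fun i =>
    (((√(μ.real (L : Set G)))⁻¹ : ℝ) : ℂ) • cosetCharacter μ hLo hLc (p i).1 (p i).2 with hv
  have hon : Orthonormal ℂ v := by
    constructor
    · intro i
      rw [← sq_eq_sq₀ (norm_nonneg _) zero_le_one, hv]
      simp only
      rw [norm_smul, mul_pow, norm_cosetCharacter_sq, Complex.norm_real, Real.norm_eq_abs, sq_abs,
        inv_pow, Real.sq_sqrt hpos.le, inv_mul_cancel₀ hpos.ne', one_pow]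
    · intro i j hij
      simp only [hv]
      rw [inner_smul_left, inner_smul_right,
        inner_cosetCharacter_eq_zero μ hLo hLc fun h => hij (hp.1 h), mul_zero, mul_zero]
  have hbot : (Submodule.span ℂ (Set.range v))ᗮ = ⊥ := by
    rw [Submodule.eq_bot_iff]
    intro f hf
    refine eq_zero_of_setIntegral_cosetSet μ hLo hLc hsep f fun x ξ => ?_
    -- The inverse compensates for the conjugation in the first slot of the inner product.
    obtain ⟨i, hi⟩ := hp.2 ((x : G ⧸ L), ((ξ⁻¹ : DualGroup G) : DualGroup G ⧸ annihilator L))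
    rw [Prod.mk.injEq] at hi
    have h0 := (Submodule.mem_orthogonal _ _).1 hf _ (Submodule.subset_span ⟨i, rfl⟩)
    simp only [hv] at h0
    rw [inner_smul_left, inner_cosetCharacter, cosetSet_congr hi.1] at h0
    have h1 := (mul_eq_zero.1 h0).resolve_left (by
      rw [Complex.conj_ofReal, Complex.ofReal_eq_zero]
      positivity)
    -- The chosen frequency agrees with `ξ⁻¹` only modulo `L^⊥`, which changes the integral by a
    -- unimodular factor.
    rw [← norm_eq_zero, norm_setIntegral_pairing_congr μ (measurableSet_cosetSet hLo x) subset_rfl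
      hi.2, inv_inv, norm_eq_zero] at h1
    exact h1
  exact ⟨HilbertBasis.mkOfOrthogonalEqBot hon hbot, fun i =>
    congrFun (HilbertBasis.coe_mkOfOrthogonalEqBot hon hbot) i⟩

include hLo hLc hsep hp in
theorem hasSum_norm_sq_cosetSet (f : Lp ℂ 2 μ) :
    HasSum (fun i => ‖∫ y in cosetSet L (p i).1, pairing y (p i).2⁻¹ * f y ∂μ‖ ^ 2)
      (μ.real (L : Set G) * ‖f‖ ^ 2) := by
  have hpos := measureReal_pos_of_isOpen_isCompact μ hLo hLc
  obtain ⟨b, hb⟩ := exists_hilbertBasis_cosetCharacter μ hLo hLc hsep hp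
  -- The factor `μ(L)` undoes the normalization by `1/√μ(L)` of the basis vectors.
  have h1 := (b.hasSum_inner_mul_inner f f).mul_left ((μ.real (L : Set G) : ℝ) : ℂ)
  rw [inner_self_eq_norm_sq_to_K] at h1
  refine Complex.hasSum_ofReal.1 ?_
  rw [Complex.ofReal_mul, Complex.ofReal_pow]
  refine h1.congr_fun fun i => ?_
  rw [← inner_conj_symm f (b i), RCLike.conj_mul, hb, inner_smul_left, inner_cosetCharacter,
    norm_mul, RCLike.norm_conj, Complex.norm_real, Real.norm_of_nonneg (by positivity)]
  have key (t : ℝ) : t ^ 2 = μ.real (L : Set G) * ((√(μ.real (L : Set G)))⁻¹ * t) ^ 2 := by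
    rw [mul_pow, inv_pow, Real.sq_sqrt hpos.le, mul_inv_cancel_left₀ hpos.ne']
  rw [key, Complex.ofReal_mul, Complex.ofReal_pow]
  rfl

include hLo hLc hsep in
/-- Parseval's identity on a measurable subset of a coset of `L`. -/
theorem hasSum_norm_sq_of_subset_cosetSet {S : Set G} {x : G} (hS : MeasurableSet S)
    (hSx : S ⊆ cosetSet L x) (f : Lp ℂ 2 μ) :
    HasSum (fun v : DualGroup G ⧸ annihilator L =>
      ‖∫ y in S, pairing y v.out⁻¹ * f y ∂μ‖ ^ 2)
      (μ.real (L : Set G) * ‖restrictLp μ hS f‖ ^ 2) := by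
  have h := hasSum_norm_sq_cosetSet μ hLo hLc hsep
    (p := fun u : (G ⧸ L) × (DualGroup G ⧸ annihilator L) => (u.1.out, u.2.out))
    (bijective_mk_out L (annihilator L)) (restrictLp μ hS f)
  simp only [setIntegral_mul_restrictLp] at h
  -- The function `χ_S f` vanishes off `x + L`, so only the terms over that coset survive.
  rw [← Function.Injective.hasSum_iff (Prod.mk_right_injective (x : G ⧸ L))] at h
  · convert h using 1
    ext v
    simp only [Function.comp_apply]
    rw [cosetSet_congr (show (((x : G ⧸ L).out : G) : G ⧸ L) = x from Quotient.out_eq' _),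
      Set.inter_eq_self_of_subset_right hSx]
  · rintro ⟨u, v⟩ huv
    have hux : ((u.out : G) : G ⧸ L) ≠ x := by
      rw [show ((u.out : G) : G ⧸ L) = u from Quotient.out_eq' _]
      rintro rfl
      exact huv ⟨v, rfl⟩
    rw [((disjoint_cosetSet hux).mono_right hSx).inter_eq, setIntegral_empty]
    simp

include hLo hLc hsep in
theorem hasSum_norm_restrictLp_sq (f : Lp ℂ 2 μ) :
    HasSum (fun u : G ⧸ L => ‖restrictLp μ (measurableSet_cosetSet hLo u.out) f‖ ^ 2)
      (‖f‖ ^ 2) := by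
  have h := HasSum.prod_fiberwise
    (hasSum_norm_sq_cosetSet μ hLo hLc hsep
    (p := fun u : (G ⧸ L) × (DualGroup G ⧸ annihilator L) => (u.1.out, u.2.out))
      (bijective_mk_out L (annihilator L)) f)
    fun u => hasSum_norm_sq_of_subset_cosetSet μ hLo hLc hsep (measurableSet_cosetSet hLo u.out)
      subset_rfl f
  exact (hasSum_mul_left_iff (measureReal_pos_of_isOpen_isCompact μ hLo hLc).ne').1 h

end CosetBasis

/-! ### The three regimes of the Gabor system -/

section GaborSystems

variable {G : Type*} [AddCommGroup G] [TopologicalSpace G]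

theorem IsSection.bijective {H : AddSubgroup G} {K : Subgroup (DualGroup G)}
    {Λ : Set (G × DualGroup G)} (hΛ : IsSection H K Λ) :
    Function.Bijective fun q : Λ => ((q.1.1 : G ⧸ H), (q.1.2 : DualGroup G ⧸ K)) := by
  constructor
  · intro q r hqr
    rw [Prod.mk.injEq] at hqr
    exact Subtype.ext ((hΛ _ _).unique ⟨q.2, hqr⟩ ⟨r.2, rfl, rfl⟩)
  · rintro ⟨u, v⟩
    obtain ⟨q, ⟨hq, h1, h2⟩, -⟩ := hΛ u v
    exact ⟨⟨q, hq⟩, Prod.ext h1 h2⟩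

variable [IsTopologicalAddGroup G] [MeasurableSpace G] [BorelSpace G] (μ : Measure G)
  [μ.IsAddHaarMeasure] {H L : AddSubgroup G} (hHo : IsOpen (H : Set G))
  (hHc : IsCompact (H : Set G)) {Λ : Set (G × DualGroup G)}

include hHo in
/-- If the frequencies of `Λ` only run through `Ĝ/L^⊥` for an open proper subgroup `L` of `H`, then
the system of characters of cosets of `H` is not complete. -/
theorem not_isCompleteSystem_of_lt (hLo : IsOpen (L : Set G)) (hLH : L < H)
    (hΛ : IsSection H (annihilator L) Λ) :
    ¬ IsCompleteSystem fun q : Λ => cosetCharacter μ hHo hHc q.1.1 q.1.2 := by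
  intro hcomp
  obtain ⟨h, hhH, hhL⟩ := SetLike.exists_of_lt hLH
  obtain ⟨η, hη, hηh⟩ := exists_mem_annihilator_pairing_ne_one hLo hhL
  have hηH : η ∉ annihilator H := fun hm => hηh (hm h hhH)
  obtain ⟨q, hq⟩ := hΛ.bijective.2 (((0 : G) : G ⧸ H), 1)
  rw [Prod.mk.injEq] at hq
  set g := cosetCharacter μ hHo hHc q.1.1 (q.1.2 * η)
  have horth : g ∈ (Submodule.span ℂ (Set.range fun r : Λ =>
      cosetCharacter μ hHo hHc r.1.1 r.1.2))ᗮ := by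
    rw [Submodule.mem_orthogonal]
    intro u hu
    induction hu using Submodule.span_induction with
    | mem u hu =>
      obtain ⟨r, rfl⟩ := hu
      refine inner_cosetCharacter_eq_zero μ hHo hHc fun heq => ?_
      rw [Prod.mk.injEq, QuotientGroup.eq] at heq
      -- A nonzero inner product puts `r.2⁻¹ q.2 η` in `H^⊥ ≤ L^⊥`. As `η ∈ L^⊥`, the points `r` and
      -- `q` represent the same class, and then `η ∈ H^⊥`.
      have hrq : r = q := by
        refine hΛ.bijective.1 (Prod.ext heq.1 (QuotientGroup.eq.2 ?_))
        have h1 := mul_mem (annihilator_anti hLH.le heq.2) (inv_mem hη)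
        rwa [← mul_assoc, mul_inv_cancel_right] at h1
      subst hrq
      rw [inv_mul_cancel_left] at heq
      exact hηH heq.2
    | zero => exact inner_zero_left _
    | add u w _ _ hu hw => rw [inner_add_left, hu, hw, add_zero]
    | smul c u _ hu => rw [inner_smul_left, hu, mul_zero]
  rw [IsCompleteSystem, Submodule.dense_iff_topologicalClosure_eq_top] at hcomp
  rw [← Submodule.orthogonal_closure, hcomp, Submodule.top_orthogonal_eq_bot,
    Submodule.mem_bot] at horth
  have hn := norm_cosetCharacter_sq μ hHo hHc q.1.1 (q.1.2 * η)
  rw [show cosetCharacter μ hHo hHc q.1.1 (q.1.2 * η) = 0 from horth, norm_zero] at hn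
  have := measureReal_pos_of_isOpen_isCompact μ hHo hHc
  rw [← hn] at this
  norm_num at this

variable [LocallyCompactSpace G] [T2Space G] [μ.Regular]
  (hsep : ∀ x : G, x ≠ 0 → ∃ ξ : DualGroup G, pairing x ξ ≠ 1)

include hsep in
theorem isOrthonormalBasis_cosetCharacter (hμH : μ (H : Set G) = 1)
    (hΛ : IsSection H (annihilator H) Λ) :
    IsOrthonormalBasis fun q : Λ => cosetCharacter μ hHo hHc q.1.1 q.1.2 := by
  obtain ⟨b, hb⟩ := exists_hilbertBasis_cosetCharacter μ hHo hHc hsep hΛ.bijective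
  refine ⟨b, funext fun q => ?_⟩
  rw [hb, measureReal_def, hμH]
  simp

include hsep in
-- Parseval for `L` is applied to each piece `f χ_{x+H}`, which is possible as `x + H ⊆ x + L`; the
-- pieces are then summed over `G ⧸ H`.
theorem isTightFrame_cosetCharacter (hLo : IsOpen (L : Set G)) (hLc : IsCompact (L : Set G))
    (hHL : H ≤ L) (hΛ : IsSection H (annihilator L) Λ) :
    IsTightFrame (μ.real (L : Set G))
      fun q : Λ => cosetCharacter μ hHo hHc q.1.1 q.1.2 := by
  have hpos := measureReal_pos_of_isOpen_isCompact μ hLo hLc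
  refine ⟨hpos, hpos, fun f => ?_⟩
  suffices h : HasSum (fun q : Λ => ‖⟪cosetCharacter μ hHo hHc q.1.1 q.1.2, f⟫_ℂ‖ ^ 2)
      (μ.real (L : Set G) * ‖f‖ ^ 2) from ⟨h.summable, h.tsum_eq.ge, h.tsum_eq.le⟩
  let F : (G ⧸ H) × (DualGroup G ⧸ annihilator L) → ℝ := fun u =>
    ‖∫ y in cosetSet H u.1.out, pairing y u.2.out⁻¹ * f y ∂μ‖ ^ 2
  have hfib (u : G ⧸ H) := hasSum_norm_sq_of_subset_cosetSet μ hLo hLc hsep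
    (measurableSet_cosetSet hHo u.out) (cosetSet_mono hHL u.out) f
  have hbase := (hasSum_norm_restrictLp_sq μ hHo hHc hsep f).mul_left (μ.real (L : Set G))
  -- All terms are nonnegative, so iterated summability suffices for joint summability.
  have hF : Summable F := by
    rw [summable_prod_of_nonneg fun _ => sq_nonneg _]
    refine ⟨fun u => (hfib u).summable, ?_⟩
    simpa only [F, (hfib _).tsum_eq] using hbase.summable
  have hFs : HasSum F (μ.real (L : Set G) * ‖f‖ ^ 2) := by
    have h1 := hF.hasSum
    rwa [(h1.prod_fiberwise hfib).unique hbase] at h1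
  -- Passing from `Quotient.out` representatives to those in `Λ` keeps each coset of `H` and changes
  -- each coefficient only by a phase.
  convert! (Equiv.ofBijective _ hΛ.bijective).hasSum_iff.2 hFs using 2 with q
  simp only [F, Function.comp_apply, Equiv.ofBijective_apply, inner_cosetCharacter]
  rw [cosetSet_congr (show (((q.1.1 : G ⧸ H).out : G) : G ⧸ H) = q.1.1 from Quotient.out_eq' _)]
  congr 1
  exact norm_setIntegral_pairing_congr μ (measurableSet_cosetSet hHo _)
    (cosetSet_mono hHL _) (Quotient.out_eq' _).symm f

end GaborSystems
end

theorem mainTheorem10 {G : Type*} [AddCommGroup G] [TopologicalSpace G] [IsTopologicalAddGroup G]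
    [LocallyCompactSpace G] [T2Space G] [MeasurableSpace G] [BorelSpace G]
    (μ : Measure G) [μ.IsAddHaarMeasure] [μ.Regular]
    (H : AddSubgroup G) (hHo : IsOpen (H : Set G)) (hHc : IsCompact (H : Set G))
    (hμH : μ (H : Set G) = 1)
    (A : G ≃ₜ+ G) (hA : IsExpansive A H)
    (φ : Lp ℂ 2 μ)
    (hφ : φ = indicatorConstLp 2 hHo.measurableSet (hHc.measure_lt_top (μ := μ)).ne (1 : ℂ))
    (k : ℤ) (Λ : Set (G × DualGroup G))
    (hΛ : IsSection H (dualPowSubgroup A (-k) (annihilator H)) Λ) :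
    (k = 0 → IsOrthonormalBasis (gaborSystem μ φ Λ)) ∧
    (0 < k → IsTightFrame ((addEquivAddHaarChar A : ℝ) ^ k) (gaborSystem μ φ Λ)) ∧
    (k < 0 → ¬ IsCompleteSystem (gaborSystem μ φ Λ)) := by
  have hg : gaborSystem μ φ Λ = fun q : Λ => cosetCharacter μ hHo hHc q.1.1 q.1.2 := by
    rw [hφ]
    exact funext fun q => gaborSystem_indicator μ hHo hHc _ Λ q
  have hsep : ∀ x : G, x ≠ 0 → ∃ ξ : DualGroup G, pairing x ξ ≠ 1 :=
    fun x hx => hA.exists_pairing_ne_one hHo hx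
  have hmono := strictMono_powSubgroup hA.1
  rw [dualPowSubgroup_neg_annihilator] at hΛ
  rw [hg]
  refine ⟨?_, fun hk => ?_, fun hk => ?_⟩
  · rintro rfl
    rw [powSubgroup_zero] at hΛ
    exact isOrthonormalBasis_cosetCharacter μ hHo hHc hsep hμH hΛ
  -- The frame constant is `μ(A^k H)`, equal to `|A|^k` because `μ(H) = 1`.
  · have hc : μ.real (powSubgroup A k H : Set G) = (addEquivAddHaarChar A : ℝ) ^ k := by
      lift k to ℕ using hk.le
      rw [measureReal_def, measure_powSubgroup, hμH, mul_one, zpow_natCast]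
      simp
    have hle := (hmono hk).le
    simp only [powSubgroup_zero] at hle
    rw [← hc]
    exact isTightFrame_cosetCharacter μ hHo hHc hsep (isOpen_powSubgroup A H hHo k)
      (isCompact_powSubgroup A H hHc k) hle hΛ
  · have hlt := hmono hk
    simp only [powSubgroup_zero] at hlt
    exact not_isCompleteSystem_of_lt μ hHo hHc (isOpen_powSubgroup A H hHo k) hlt hΛ
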